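/- Let $q>1$ be real. A $q$-expansion of a real number $x$ is a sequence $(\delta_i)_{i\ge 1}\in\{0,1\}^{\mathbb N}$ with $x=\sum_{i=1}^{\infty}\delta_i q^{-i}$. Let $q_3\approx 1.68042$ be the unique real root greater than $1$ of the polynomial $x^5-x^4-x^3-x+1$. Then for every $q\in(1,q_3)\setminus\left\{\frac{1+\sqrt5}{2}\right\}$, the set of $q$-expansions of $1$ has cardinality $2^{\aleph_0}$. -/

import Mathlib

/-- The set `Σ_q(x)` of all `q`-expansions of `x`: the sequences `(δ₁, δ₂, …)` of digits in
`{0, 1}` with `x = ∑_{i ≥ 1} δ_i / q ^ i`. The digit `δ_{i+1}` is `δ i`. -/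
def qExpansions (q x : ℝ) : Set (ℕ → Fin 2) :=
  {δ | HasSum (fun i : ℕ => ((δ i : ℕ) : ℝ) / q ^ (i + 1)) x}

/-- `x ^ 5 - x ^ 4 - x ^ 3 - x + 1` has exactly one real root greater than `1`. -/
theorem existsUnique_q₃ : ∃! x : ℝ, 1 < x ∧ x ^ 5 - x ^ 4 - x ^ 3 - x + 1 = 0 := by
  have key : ∀ x y : ℝ, 1 < x → x ^ 5 - x ^ 4 - x ^ 3 - x + 1 = 0 →
      y ^ 5 - y ^ 4 - y ^ 3 - y + 1 = 0 → ¬ x < y := by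
    intro x y hx hfx hfy hxy
    have h1 : (x - 1) * (x ^ 4 - 1) = x ^ 3 := by linear_combination hfx
    have h2 : (y - 1) * (y ^ 4 - 1) = y ^ 3 := by linear_combination hfy
    have h3 : x ^ 3 < y ^ 3 := by gcongr
    have h4 : 0 < x ^ 3 * y ^ 3 * (y - x) :=
      mul_pos (mul_pos (by positivity) (pow_pos (by linarith) 3)) (by linarith)
    have h5 : y ^ 3 * (x ^ 4 - 1) < x ^ 3 * (y ^ 4 - 1) := by nlinarith
    have h6 : 0 < y ^ 3 * (x ^ 4 - 1) :=
      mul_pos (pow_pos (by linarith) 3) (by linarith [one_lt_pow₀ hx (n := 4) (by norm_num)])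
    have h7 : (x - 1) * (y ^ 3 * (x ^ 4 - 1)) < (y - 1) * (x ^ 3 * (y ^ 4 - 1)) :=
      mul_lt_mul (by linarith) h5.le h6 (by linarith)
    have h8 : (x - 1) * (y ^ 3 * (x ^ 4 - 1)) = (y - 1) * (x ^ 3 * (y ^ 4 - 1)) := by
      linear_combination y ^ 3 * h1 - x ^ 3 * h2
    exact h7.ne h8
  obtain ⟨x, ⟨hx1, -⟩, hx⟩ : (0 : ℝ) ∈
      (fun x : ℝ => x ^ 5 - x ^ 4 - x ^ 3 - x + 1) '' Set.Icc (3 / 2) 2 :=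
    intermediate_value_Icc (by norm_num) (by fun_prop) ⟨by norm_num, by norm_num⟩
  refine ⟨x, ⟨by linarith, hx⟩, ?_⟩
  rintro y ⟨hy1, hy⟩
  exact le_antisymm (not_lt.1 (key x y (by linarith) hx hy)) (not_lt.1 (key y x hy1 hy hx))

/-- `q₃ ≈ 1.68042`, the unique root of `x ^ 5 - x ^ 4 - x ^ 3 - x + 1` greater than `1`. -/
noncomputable def q₃ : ℝ := existsUnique_q₃.choose

theorem q₃_spec : 1 < q₃ ∧ q₃ ^ 5 - q₃ ^ 4 - q₃ ^ 3 - q₃ + 1 = 0 :=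
  existsUnique_q₃.choose_spec.1

/-! Choosing the digits of an expansion means iterating x ↦ qx and x ↦ qx - 1 inside [0, 1/(q - 1)];
both images stay inside exactly on the switch region 1 ≤ qx ≤ 1/(q - 1). If from each point of a
bounded class one can reach, within the class, a point with both images in the class, then {0,1}^ℕ
injects into the expansions (`mk_qExpansions_of_branches`). Below the golden ratio the open interval
is such a class.

Above it, the class consists of the points of ℤ[q] that can reach the switch region. Suppose one
never branches. It leads to a switch point with one image avoiding the region forever; up to the
reflection x ↦ 1/(q - 1) - x, that image is t/(q² - 1) with t = 0 or t = q^(-a), a ≥ 1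
(`eq_of_not_hits`). The other image again never branches and leads to a new t, for which only two
values are possible (`StuckAt.next_of_le`, `StuckAt.next_two`, `StuckAt.next_one`). Comparing these
values with the powers of q⁻¹ shows, for q < q₃, that q⁻³ or q⁻¹ must be its own successor
(`StuckAt.of_inv_pow`). Then q is a root of one of two irreducible sextics f with f(1) = -5 or -3,
whereas a nonzero t with t/(q² - 1) or its reflection in ℤ[q] forces f(1) = ±1
(`StuckAt.isUnit_eval_one`). Since 1 lies in ℤ[q], it has a continuum of expansions. -/

/-! ### Branching orbits and expansions -/

/-- From `x`, some composition of the maps `x ↦ q * x` and `x ↦ q * x - 1` leads to a point whose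
two images satisfy `Q`, through points that satisfy `Q`. -/
inductive Branches (q : ℝ) (Q : ℝ → Prop) : ℝ → Prop
  | here {x : ℝ} : Q (q * x) → Q (q * x - 1) → Branches q Q x
  | zero {x : ℝ} : Q (q * x) → Branches q Q (q * x) → Branches q Q x
  | one {x : ℝ} : Q (q * x - 1) → Branches q Q (q * x - 1) → Branches q Q x

open Classical in
/-- The digit chosen at the point `p.1` when `p.2` choices have been made so far: the next term of
`s` if both images satisfy `Q`, and otherwise the digit that keeps the orbit in `Q`. -/
noncomputable def branchDigit (q : ℝ) (Q : ℝ → Prop) (s : ℕ → Fin 2) (p : ℝ × ℕ) : Fin 2 :=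
  if Q (q * p.1) ∧ Q (q * p.1 - 1) then s p.2 else if Q (q * p.1) then 0 else 1

open Classical in
/-- One step of the orbit that follows `branchDigit`. -/
noncomputable def branchStep (q : ℝ) (Q : ℝ → Prop) (s : ℕ → Fin 2) (p : ℝ × ℕ) : ℝ × ℕ :=
  (q * p.1 - (branchDigit q Q s p : ℕ), if Q (q * p.1) ∧ Q (q * p.1 - 1) then p.2 + 1 else p.2)

/-- The orbit of `x` that makes its choices according to `s`. -/
noncomputable def branchState (q : ℝ) (Q : ℝ → Prop) (s : ℕ → Fin 2) (x : ℝ) (n : ℕ) : ℝ × ℕ :=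
  (branchStep q Q s)^[n] (x, 0)

section Branching

variable {q : ℝ} {Q : ℝ → Prop}

theorem branchState_succ (s : ℕ → Fin 2) (x : ℝ) (n : ℕ) :
    branchState q Q s x (n + 1) = branchStep q Q s (branchState q Q s x n) :=
  Function.iterate_succ_apply' _ _ _

theorem branchStep_mem (hB : ∀ x, Q x → Branches q Q x) (s : ℕ → Fin 2) (p : ℝ × ℕ)
    (hp : Q p.1) : Q (branchStep q Q s p).1 := by
  have h := hB _ hp
  have h01 : Q (q * p.1) ∨ Q (q * p.1 - 1) := by
    cases h with
    | here h _ => exact .inl h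
    | zero h _ => exact .inl h
    | one h _ => exact .inr h
  unfold branchStep branchDigit
  by_cases h0 : Q (q * p.1) <;> by_cases h1 : Q (q * p.1 - 1)
  · obtain h | h : s p.2 = 0 ∨ s p.2 = 1 := by omega
    all_goals simp [h0, h1, h]
  · simp [h0, h1]
  · simp [h0, h1]
  · tauto

theorem branchState_mem (hB : ∀ x, Q x → Branches q Q x) (s : ℕ → Fin 2) {x : ℝ} (hx : Q x)
    (n : ℕ) : Q (branchState q Q s x n).1 := by
  induction n with
  | zero => exact hx
  | succ n ih => rw [branchState_succ]; exact branchStep_mem hB s _ ih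

/-- Along the orbit that follows `s`, the next branching point is reached. -/
theorem exists_branch_of_branches (s : ℕ → Fin 2) {y : ℝ} (h : Branches q Q y) :
    ∀ {x : ℝ} (n : ℕ), (branchState q Q s x n).1 = y →
      ∃ m, (branchState q Q s x m).2 = (branchState q Q s x n).2 ∧
        Q (q * (branchState q Q s x m).1) ∧ Q (q * (branchState q Q s x m).1 - 1) := by
  induction h with
  | here h0 h1 => intro x n hn; exact ⟨n, rfl, by rw [hn]; exact h0, by rw [hn]; exact h1⟩
  | @zero y h0 _ ih =>
    intro x n hn
    by_cases h1 : Q (q * y - 1)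
    · exact ⟨n, rfl, by rw [hn]; exact h0, by rw [hn]; exact h1⟩
    -- The other image is outside `Q`, so the digit is forced and the counter of choices does not
    -- move.
    · have := @ih x (n + 1) (by simp [branchState_succ, branchStep, branchDigit, hn, h0, h1])
      simpa [branchState_succ, branchStep, hn, h1] using this
  | @one y h1 _ ih =>
    intro x n hn
    by_cases h0 : Q (q * y)
    · exact ⟨n, rfl, by rw [hn]; exact h0, by rw [hn]; exact h1⟩
    · have := @ih x (n + 1) (by simp [branchState_succ, branchStep, branchDigit, hn, h0])
      simpa [branchState_succ, branchStep, hn, h0] using this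

/-- Every choice gets made. -/
theorem exists_branchState_eq (hB : ∀ x, Q x → Branches q Q x) (s : ℕ → Fin 2) {x : ℝ}
    (hx : Q x) (i : ℕ) :
    ∃ m, (branchState q Q s x m).2 = i ∧
      Q (q * (branchState q Q s x m).1) ∧ Q (q * (branchState q Q s x m).1 - 1) := by
  induction i with
  | zero => exact exists_branch_of_branches s (hB _ hx) 0 rfl
  | succ i ih =>
    obtain ⟨m, hm, h⟩ := ih
    obtain ⟨k, hk, h'⟩ :=
      exists_branch_of_branches s (hB _ (branchState_mem hB s hx (m + 1))) (m + 1) rfl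
    exact ⟨k, by rw [hk, branchState_succ, branchStep, if_pos h, hm], h'⟩

/-- Equal digits force equal states, counters included, and at the state where choice `i` is made
the digit is `s i`. -/
theorem branchDigit_injective (hB : ∀ x, Q x → Branches q Q x) {x : ℝ} (hx : Q x) :
    Function.Injective fun s n => branchDigit q Q s (branchState q Q s x n) := by
  intro s s' h
  have hst : ∀ n, branchState q Q s x n = branchState q Q s' x n := by
    intro n
    induction n with
    | zero => rfl
    | succ n ih =>
      have := congrFun h n
      simp only [branchState_succ, branchStep] at this ⊢
      rw [this, ih]
  funext i
  obtain ⟨m, rfl, h2⟩ := exists_branchState_eq hB s hx i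
  have := congrFun h m
  beta_reduce at this
  rw [← hst m] at this
  simpa only [branchDigit, if_pos h2] using this

/-- The partial sums telescope to x₀ - xₙ q⁻ⁿ, and boundedness of the orbit kills the remainder. -/
theorem mem_qExpansions_of_orbit (hq : 1 < q) {x : ℕ → ℝ} {δ : ℕ → Fin 2}
    (hx : ∀ n, x (n + 1) = q * x n - (δ n : ℕ)) {C : ℝ} (hC : ∀ n, |x n| ≤ C) :
    δ ∈ qExpansions q (x 0) := by
  have hq0 : q ≠ 0 := by positivity
  have hs : ∀ n, ∑ i ∈ Finset.range n, ((δ i : ℕ) : ℝ) / q ^ (i + 1) = x 0 - x n * (q⁻¹) ^ n := by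
    intro n
    induction n with
    | zero => simp
    | succ n ih =>
      rw [Finset.sum_range_succ, ih, hx n, inv_pow, inv_pow]
      field_simp
      ring
  refine (hasSum_iff_tendsto_nat_of_nonneg (fun i => by positivity) _).2 ?_
  simp only [hs]
  have h0 : Filter.Tendsto (fun n => (q⁻¹) ^ n) Filter.atTop (nhds 0) :=
    tendsto_pow_atTop_nhds_zero_of_lt_one (by positivity) (inv_lt_one_of_one_lt₀ hq)
  have h1 : Filter.Tendsto (fun n => x n * (q⁻¹) ^ n) Filter.atTop (nhds 0) := by
    refine squeeze_zero_norm (a := fun n => C * (q⁻¹) ^ n) (fun n => ?_) (by simpa using h0.const_mul C)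
    rw [norm_mul, Real.norm_eq_abs, norm_pow, norm_inv, Real.norm_of_nonneg (by positivity : 0 ≤ q)]
    gcongr
    exact hC n
  simpa using h1.const_sub (x 0)

/-- If every point satisfying `Q` branches, then such a point has a continuum of expansions. -/
theorem mk_qExpansions_of_branches (hq : 1 < q) {C : ℝ} (hC : ∀ x, Q x → |x| ≤ C)
    (hB : ∀ x, Q x → Branches q Q x) {x : ℝ} (hx : Q x) :
    Cardinal.mk (qExpansions q x) = 2 ^ Cardinal.aleph0 := by
  have hfull : Cardinal.mk (ℕ → Fin 2) = 2 ^ Cardinal.aleph0 := by simp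
  refine le_antisymm ((Cardinal.mk_set_le _).trans_eq hfull) ?_
  rw [← hfull]
  refine Cardinal.mk_le_of_injective (f := fun s => (⟨fun n => branchDigit q Q s
    (branchState q Q s x n), ?_⟩ : qExpansions q x)) ?_
  · exact mem_qExpansions_of_orbit hq (x := fun n => (branchState q Q s x n).1)
      (fun n => by simp only [branchState_succ, branchStep]) (fun n => hC _ (branchState_mem hB s hx n))
  · intro s s' h
    exact branchDigit_injective hB hx (Subtype.ext_iff.1 h)

end Branching

/-! ### Bases below the golden ratio -/

/-- Below the golden ratio, the interior points of `[0, 1 / (q - 1)]` branch. -/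
theorem branches_interior {q : ℝ} (hq : 1 < q) (hq' : q ^ 2 - q - 1 < 0) (x : ℝ)
    (hx : 0 < x ∧ x < 1 / (q - 1)) :
    Branches q (fun x => 0 < x ∧ x < 1 / (q - 1)) x := by
  set b := 1 / (q - 1) with hb
  have hbq : b * q = b + 1 := by
    have : b * (q - 1) = 1 := by rw [hb]; exact one_div_mul_cancel (by linarith)
    linarith
  -- Here the golden ratio enters: multiplying a point of (0, 1] by q cannot pass 1/(q - 1), so once
  -- the product exceeds 1 both images are interior.
  have hb1 : q < b := by rw [hb, lt_div_iff₀ (by linarith)]; nlinarith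
  have hlow : ∀ (n : ℕ) (x : ℝ), 0 < x → x ≤ 1 → 1 < q ^ (n + 1) * x →
      Branches q (fun x => 0 < x ∧ x < b) x := by
    intro n
    induction n with
    | zero =>
      intro x h0 h1 h
      simp only [zero_add, pow_one] at h
      exact .here ⟨by linarith, by nlinarith⟩ ⟨by linarith, by nlinarith⟩
    | succ n ih =>
      intro x h0 h1 h
      rcases lt_or_ge 1 (q * x) with h2 | h2
      · exact .here ⟨by linarith, by nlinarith⟩ ⟨by linarith, by nlinarith⟩
      · have h3 : 0 < q * x := by positivity
        exact .zero ⟨h3, by linarith⟩ (ih _ h3 h2 (by rw [← mul_assoc, ← pow_succ]; exact h))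
  have hhigh : ∀ (n : ℕ) (x : ℝ), x < b → b - x ≤ 1 → 1 < q ^ (n + 1) * (b - x) →
      Branches q (fun x => 0 < x ∧ x < b) x := by
    intro n
    induction n with
    | zero =>
      intro x h0 h1 h
      simp only [zero_add, pow_one] at h
      exact .here ⟨by nlinarith, by nlinarith⟩ ⟨by nlinarith, by nlinarith⟩
    | succ n ih =>
      intro x h0 h1 h
      have h4 : b - (q * x - 1) = q * (b - x) := by linear_combination -hbq
      rcases lt_or_ge 1 (q * (b - x)) with h2 | h2
      · exact .here ⟨by nlinarith, by nlinarith⟩ ⟨by nlinarith, by nlinarith⟩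
      · have h3 : 0 < q * (b - x) := mul_pos (by linarith) (by linarith)
        refine .one ⟨by linarith, by linarith⟩ (ih _ (by linarith) (by linarith) ?_)
        rw [h4, ← mul_assoc, ← pow_succ]
        exact h
  have hpow : ∀ y : ℝ, 0 < y → ∃ n : ℕ, 1 < q ^ (n + 1) * y := by
    intro y hy
    obtain ⟨n, hn⟩ := pow_unbounded_of_one_lt (1 / y) hq
    refine ⟨n, ?_⟩
    rw [div_lt_iff₀ hy] at hn
    exact hn.trans (mul_lt_mul_of_pos_right (pow_lt_pow_right₀ hq n.lt_succ_self) hy)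
  rcases le_or_gt x 1 with h1 | h1
  · obtain ⟨n, hn⟩ := hpow x hx.1
    exact hlow n x hx.1 h1 hn
  rcases le_or_gt (b - x) 1 with h2 | h2
  · obtain ⟨n, hn⟩ := hpow (b - x) (by linarith [hx.2])
    exact hhigh n x hx.2 h2 hn
  · exact .here ⟨by nlinarith, by nlinarith⟩ ⟨by nlinarith, by nlinarith⟩

/-! ### Reaching and avoiding the switch region -/

/-- Some composition of the maps `x ↦ q * x` and `x ↦ q * x - 1` sends `x` into the switch region
`[1 / q, 1 / (q * (q - 1))]`. -/
inductive Hits (q : ℝ) : ℝ → Prop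
  | mem {x : ℝ} : 1 ≤ q * x → q * x ≤ (q - 1)⁻¹ → Hits q x
  | zero {x : ℝ} : Hits q (q * x) → Hits q x
  | one {x : ℝ} : Hits q (q * x - 1) → Hits q x

section Hits

variable {q : ℝ}

theorem inv_sub_one_mul (hq : 1 < q) : (q - 1)⁻¹ * q = (q - 1)⁻¹ + 1 := by
  have : (q - 1)⁻¹ * (q - 1) = 1 := inv_mul_cancel₀ (by linarith)
  linarith

/-- The inverses of both maps preserve [0, 1/(q - 1)]. -/
theorem Hits.mem_Icc (hq : 1 < q) {x : ℝ} (h : Hits q x) : 0 ≤ x ∧ x ≤ (q - 1)⁻¹ := by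
  have hb := inv_sub_one_mul hq
  have hb0 : 0 < (q - 1)⁻¹ := inv_pos.2 (by linarith)
  induction h with
  | mem h1 h2 => exact ⟨by nlinarith, by nlinarith⟩
  | zero _ ih => exact ⟨by nlinarith [ih.1], by nlinarith [ih.2]⟩
  | one _ ih => exact ⟨by nlinarith [ih.1], by nlinarith [ih.2]⟩

/-- Reflection preserves the switch region and exchanges the two maps. -/
theorem Hits.reflect (hq : 1 < q) {x : ℝ} (h : Hits q x) : Hits q ((q - 1)⁻¹ - x) := by
  have hb := inv_sub_one_mul hq
  induction h with
  | mem h1 h2 => exact .mem (by linarith) (by linarith)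
  | zero _ ih => exact .one (by convert ih using 1; linear_combination hb)
  | one _ ih => exact .zero (by convert ih using 1; linear_combination hb)

theorem bounds_of_mem_Ioo (hq : 1 < q) (hφ : 0 < q ^ 2 - q - 1)
    (hφ' : (q ^ 2 - q - 1) * q ^ 3 < q - 1) : 1.618 < q ∧ q < 1.6805 := by
  refine ⟨by nlinarith, ?_⟩
  by_contra! h
  -- Expanded about 1.6805, just above q₃, the quintic has only nonnegative coefficients.
  obtain ⟨s, rfl⟩ : ∃ s, q = 1.6805 + s := ⟨q - 1.6805, by ring⟩
  have hs : 0 ≤ s := by linarith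
  have h2 : 0 ≤ s ^ 2 := by positivity
  have h3 : 0 ≤ s ^ 3 := by positivity
  have h4 : 0 ≤ s ^ 4 := by positivity
  have h5 : 0 ≤ s ^ 5 := by positivity
  ring_nf at hφ'
  linarith

/-- A point between the switch region and `1` whose orbit avoids the switch region has period `2`. -/
theorem eq_of_not_hits_of_lt_one (hq : 1 < q) (hφ : 0 < q ^ 2 - q - 1)
    (hφ' : (q ^ 2 - q - 1) * q ^ 3 < q - 1) {x : ℝ} (h0 : (q - 1)⁻¹ < q * x) (h1 : x < 1)
    (hx : ¬ Hits q x) : x = q / (q ^ 2 - 1) := by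
  have hb := inv_sub_one_mul hq
  have hb0 : 0 < (q - 1)⁻¹ := inv_pos.2 (by linarith)
  have hb1 : (q - 1)⁻¹ < q := by rw [inv_lt_iff_one_lt_mul₀ (by linarith)]; nlinarith
  -- This bound keeps the two-step map below from jumping over the switch region.
  have hb2 : q ^ 2 - q < (q - 1)⁻¹ := by
    rw [inv_eq_one_div, lt_div_iff₀ (by linarith)]
    obtain ⟨-, h⟩ := bounds_of_mem_Ioo hq hφ hφ'
    nlinarith
  -- Digits 1 and 0 are forced in turn; together they act as y ↦ q(qy - 1), which expands by q²
  -- about its fixed point q/(q² - 1). A bounded orbit must be that point.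
  have key : ∀ n : ℕ, ∃ y, (q - 1)⁻¹ < q * y ∧ y < 1 ∧ ¬ Hits q y ∧
      y - q / (q ^ 2 - 1) = (q ^ 2) ^ n * (x - q / (q ^ 2 - 1)) := by
    intro n
    induction n with
    | zero => exact ⟨x, h0, h1, hx, by ring⟩
    | succ n ih =>
      obtain ⟨y, hy0, hy1, hy2, hy3⟩ := ih
      have hz : ¬ Hits q (q * y - 1) := fun h => hy2 (.one h)
      have hw : ¬ Hits q (q * (q * y - 1)) := fun h => hz (.zero h)
      have hz1 : q * (q * y - 1) < 1 := by
        by_contra! h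
        exact hz (.mem h (by nlinarith))
      have hw1 : (q - 1)⁻¹ < q * (q * (q * y - 1)) := by
        by_contra! h
        refine hw (.mem ?_ h)
        have h5 : q * (q * ((q - 1)⁻¹ - 1)) ≤ q * (q * (q * y - 1)) := by gcongr
        linear_combination hb2.le + h5 - (1 + q) * hb
      refine ⟨q * (q * y - 1), hw1, hz1, hw, ?_⟩
      have h6 : q ^ 2 - 1 ≠ 0 := by nlinarith
      rw [pow_succ (q ^ 2), mul_right_comm, ← hy3]
      field_simp
      ring
  by_contra hne
  have hpos : 0 < |x - q / (q ^ 2 - 1)| := abs_pos.2 (sub_ne_zero.2 hne)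
  obtain ⟨n, hn⟩ := pow_unbounded_of_one_lt (1 / |x - q / (q ^ 2 - 1)|)
    (show 1 < q ^ 2 by nlinarith)
  obtain ⟨y, hy0, hy1, -, hy3⟩ := key n
  rw [div_lt_iff₀ hpos] at hn
  have h2 : |y - q / (q ^ 2 - 1)| < 1 := by
    have h3 : 0 < q / (q ^ 2 - 1) := div_pos (by linarith) (by nlinarith)
    have h4 : q / (q ^ 2 - 1) < 1 := by rw [div_lt_one (by nlinarith)]; linarith
    have h5 : 0 < y := by nlinarith
    rw [abs_lt]
    constructor <;> linarith
  rw [hy3, abs_mul, abs_of_pos (by positivity : 0 < (q ^ 2) ^ n)] at h2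
  linarith

/-- The points of `[1, 1 / (q - 1)]` whose orbit avoids the switch region. -/
theorem eq_of_not_hits (hq : 1 < q) (hφ : 0 < q ^ 2 - q - 1)
    (hφ' : (q ^ 2 - q - 1) * q ^ 3 < q - 1) {x : ℝ} (h1 : 1 ≤ x) (hx1 : x ≤ (q - 1)⁻¹)
    (hx : ¬ Hits q x) : x = (q - 1)⁻¹ ∨ ∃ b : ℕ, 1 ≤ b ∧
      x = (q - 1)⁻¹ - (q⁻¹) ^ b / (q ^ 2 - 1) := by
  have hb := inv_sub_one_mul hq
  rcases hx1.eq_or_lt with h | h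
  · exact .inl h
  right
  -- Digit 1 multiplies the distance to 1/(q - 1) by q. The first iterate below 1 lies between the
  -- switch region and 1, so it is the point of period 2.
  have hits : ∀ n : ℕ, ¬ Hits q ((q - 1)⁻¹ - q ^ n * ((q - 1)⁻¹ - x)) := by
    intro n
    induction n with
    | zero => simpa using hx
    | succ n ih =>
      refine fun h => ih (.one ?_)
      convert h using 1
      linear_combination hb
  have hex : ∃ n : ℕ, (q - 1)⁻¹ - q ^ n * ((q - 1)⁻¹ - x) < 1 := by
    obtain ⟨n, hn⟩ := pow_unbounded_of_one_lt ((q - 1)⁻¹ / ((q - 1)⁻¹ - x)) hq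
    refine ⟨n, ?_⟩
    rw [div_lt_iff₀ (by linarith)] at hn
    linarith
  classical
  obtain ⟨n, hn, hmin⟩ : ∃ n : ℕ, (q - 1)⁻¹ - q ^ n * ((q - 1)⁻¹ - x) < 1 ∧
      ∀ m < n, ¬ (q - 1)⁻¹ - q ^ m * ((q - 1)⁻¹ - x) < 1 :=
    ⟨Nat.find hex, Nat.find_spec hex, fun m hm => Nat.find_min hex hm⟩
  have hn0 : n ≠ 0 := by rintro rfl; norm_num at hn; linarith
  obtain ⟨m, rfl⟩ := Nat.exists_eq_succ_of_ne_zero hn0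
  have hm := not_lt.1 (hmin m (Nat.lt_succ_self m))
  set y := (q - 1)⁻¹ - q ^ (m + 1) * ((q - 1)⁻¹ - x) with hy
  have hy1 : q - 1 ≤ y := by
    have : y = q * ((q - 1)⁻¹ - q ^ m * ((q - 1)⁻¹ - x)) - 1 := by
      rw [hy]; linear_combination -hb
    rw [this]
    nlinarith
  have hy2 : (q - 1)⁻¹ < q * y := by
    by_contra! h
    exact hits (m + 1) (.mem (by nlinarith) h)
  have hy3 := eq_of_not_hits_of_lt_one hq hφ hφ' hy2 hn (hits (m + 1))
  refine ⟨m + 1, by omega, ?_⟩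
  have h5 : q ^ (m + 1) * ((q - 1)⁻¹ - x) = 1 / (q ^ 2 - 1) := by
    have h6 : (q - 1)⁻¹ - q / (q ^ 2 - 1) = 1 / (q ^ 2 - 1) := by
      have h7 : q ^ 2 - 1 = (q - 1) * (q + 1) := by ring
      have h8 : q - 1 ≠ 0 := by linarith
      have h9 : q + 1 ≠ 0 := by linarith
      rw [h7]
      field_simp
      ring
    rw [← h6, ← hy3, hy]
    ring
  have h6 : (q⁻¹) ^ (m + 1) * (q ^ (m + 1) * ((q - 1)⁻¹ - x)) = (q - 1)⁻¹ - x := by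
    rw [← mul_assoc, ← mul_pow, inv_mul_cancel₀ (by linarith), one_pow, one_mul]
  rw [h5] at h6
  linear_combination h6

end Hits

/-! ### Nonbranching orbits and their tails -/

/-- The points of the ring `R` from which the switch region can be reached. -/
def HitsIn (q : ℝ) (R : Subring ℝ) (x : ℝ) : Prop := Hits q x ∧ x ∈ R

/-- The points from which the switch region, but no branching can be reached. -/
def NonBranching (q : ℝ) (R : Subring ℝ) (x : ℝ) : Prop :=
  HitsIn q R x ∧ ¬ Branches q (HitsIn q R) x

/-- `x` or its reflection is nonbranching. -/
def Stuck (q : ℝ) (R : Subring ℝ) (x : ℝ) : Prop :=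
  NonBranching q R x ∨ NonBranching q R ((q - 1)⁻¹ - x)

/-- `t / (q ^ 2 - 1)` is a number whose only expansions are `0 … 0 (01)^∞` or `0^∞`. -/
def IsTail (q t : ℝ) : Prop := t = 0 ∨ ∃ b : ℕ, 1 ≤ b ∧ t = (q⁻¹) ^ b

/-- The nonbranching orbit continues in a point next to one with the unique expansion `t`. -/
def StuckAt (q : ℝ) (R : Subring ℝ) (t : ℝ) : Prop :=
  Stuck q R ((q - 1)⁻¹ - t / (q ^ 2 - 1) - 1) ∧
    (t / (q ^ 2 - 1) ∈ R ∨ (q - 1)⁻¹ - t / (q ^ 2 - 1) ∈ R) ∧ IsTail q t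

section Stuck

variable {q : ℝ} {R : Subring ℝ}

/-- As qx - 1 is negative and cannot reach the switch region, the digit 0 is forced. -/
theorem NonBranching.zero (hq : 1 < q) (hR : q ∈ R) {x : ℝ} (hx : q * x < 1)
    (h : NonBranching q R x) : NonBranching q R (q * x) := by
  obtain ⟨⟨hx1, hx2⟩, hx3⟩ := h
  have hQ : HitsIn q R (q * x) := by
    refine ⟨?_, R.mul_mem hR hx2⟩
    cases hx1 with
    | mem h _ => linarith
    | zero h => exact h
    | one h => linarith [(h.mem_Icc hq).1]
  exact ⟨hQ, fun h => hx3 (.zero hQ h)⟩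

theorem NonBranching.one (hq : 1 < q) (hR : q ∈ R) {x : ℝ} (hx : (q - 1)⁻¹ < q * x)
    (h : NonBranching q R x) : NonBranching q R (q * x - 1) := by
  obtain ⟨⟨hx1, hx2⟩, hx3⟩ := h
  have hQ : HitsIn q R (q * x - 1) := by
    refine ⟨?_, R.sub_mem (R.mul_mem hR hx2) R.one_mem⟩
    cases hx1 with
    | mem _ h => linarith
    | zero h => linarith [(h.mem_Icc hq).2]
    | one h => exact h
  exact ⟨hQ, fun h => hx3 (.one hQ h)⟩

theorem Stuck.zero (hq : 1 < q) (hR : q ∈ R) {x : ℝ} (hx : q * x < 1) (h : Stuck q R x) :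
    Stuck q R (q * x) := by
  have hb := inv_sub_one_mul hq
  refine h.imp (fun h => h.zero hq hR hx) fun h => ?_
  convert h.one hq hR (by linarith) using 1
  linear_combination -hb

/-- Outside the switch region only one image stays in [0, 1/(q - 1)], so the path given by `Hits` is
forced and stays nonbranching until it enters the region. -/
theorem NonBranching.exists_switch (hq : 1 < q) (hR : q ∈ R) {x : ℝ} (h : NonBranching q R x) :
    ∃ w, NonBranching q R w ∧ 1 ≤ q * w ∧ q * w ≤ (q - 1)⁻¹ := by
  obtain hx := h.1.1
  induction hx with
  | @mem x h1 h2 => exact ⟨x, h, h1, h2⟩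
  | @zero x hx ih =>
    rcases lt_or_ge (q * x) 1 with h1 | h1
    · exact ih (h.zero hq hR h1)
    · exact ⟨x, h, h1, (hx.mem_Icc hq).2⟩
  | @one x hx ih =>
    rcases lt_or_ge (q - 1)⁻¹ (q * x) with h1 | h1
    · exact ih (h.one hq hR h1)
    · exact ⟨x, h, by linarith [(hx.mem_Icc hq).1], h1⟩

theorem IsTail.nonneg (hq : 1 < q) {t : ℝ} (ht : IsTail q t) : 0 ≤ t := by
  rcases ht with rfl | ⟨b, -, rfl⟩ <;> positivity

theorem IsTail.le_inv (hq : 1 < q) {t : ℝ} (ht : IsTail q t) : t ≤ q⁻¹ := by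
  rcases ht with rfl | ⟨b, hb, rfl⟩
  · positivity
  · exact pow_le_of_le_one (by positivity) (inv_le_one_of_one_le₀ hq.le) (by omega)

/-- Reduces case analyses to a few explicit powers and a numerically small remainder, which includes
the zero tail. -/
theorem IsTail.eq_or_le (hq : 1 < q) (k : ℕ) {t : ℝ} (ht : IsTail q t) :
    (∃ b, 1 ≤ b ∧ b ≤ k ∧ t = (q⁻¹) ^ b) ∨ t ≤ (q⁻¹) ^ (k + 1) := by
  rcases ht with rfl | ⟨b, hb, rfl⟩
  · right; positivity
  · rcases le_or_gt b k with h | h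
    · exact .inl ⟨b, hb, h, rfl⟩
    · exact .inr (pow_le_pow_of_le_one (by positivity) (inv_le_one_of_one_le₀ hq.le) h)

/-- Two tails cannot add up to `2 + q - q ^ 2`. -/
theorem IsTail.add_ne (hq : 1 < q) (hφ : 0 < q ^ 2 - q - 1)
    (hφ' : (q ^ 2 - q - 1) * q ^ 3 < q - 1) {s t : ℝ} (hs : IsTail q s) (ht : IsTail q t) :
    s + t ≠ 2 + q - q ^ 2 := by
  intro h
  obtain ⟨hq1, hq2⟩ := bounds_of_mem_Ioo hq hφ hφ'
  obtain ⟨r, hr⟩ : ∃ r, r = q⁻¹ := ⟨_, rfl⟩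
  have hrq : r * q = 1 := by rw [hr]; exact inv_mul_cancel₀ (by linarith)
  have hr0 : r < 0.6181 := by nlinarith
  have hr1 : 0.595 < r := by nlinarith
  have hr2 : r ^ 2 < 0.3821 := by nlinarith
  have hr3 : r ^ 3 < 0.2362 := by nlinarith
  have hq3 : q ^ 2 - q < 1.1436 := by nlinarith
  have key : ∀ s t, IsTail q s → IsTail q t → s ≤ t → s + t ≠ 2 + q - q ^ 2 := by
    intro s t hs ht hst h
    have hs1 := hs.eq_or_le hq 2
    have ht1 := ht.eq_or_le hq 1
    rw [← hr] at hs1 ht1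
    -- Otherwise both tails are at most q⁻², and 2q⁻² is too small.
    have : t = r := by
      rcases ht1 with ⟨b, hb, hb', rfl⟩ | ht1
      · obtain rfl : b = 1 := by omega
        simp
      · norm_num at ht1
        linarith
    subst this
    rcases hs1 with ⟨b, hb, hb', rfl⟩ | hs1
    · interval_cases b
      · rw [pow_one] at h
        linarith
      -- The sum q⁻² + q⁻¹ would be right only at the golden ratio.
      · have : (q ^ 2 - q - 1) * (1 - t ^ 2) = 0 := by
          linear_combination h - (1 + q * t - t) * hrq
        nlinarith
    · norm_num at hs1
      linarith
  rcases le_total s t with hst | hst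
  · exact key s t hs ht hst h
  · exact key t s ht hs hst (by linarith)

theorem exists_isTail_of_not_hits (hq : 1 < q) (hφ : 0 < q ^ 2 - q - 1)
    (hφ' : (q ^ 2 - q - 1) * q ^ 3 < q - 1) {x : ℝ} (h1 : 1 ≤ x) (hx1 : x ≤ (q - 1)⁻¹)
    (hx : ¬ Hits q x) : ∃ t, IsTail q t ∧ x = (q - 1)⁻¹ - t / (q ^ 2 - 1) := by
  rcases eq_of_not_hits hq hφ hφ' h1 hx1 hx with h | ⟨b, hb, h⟩
  · exact ⟨0, .inl rfl, by simp [h]⟩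
  · exact ⟨_, .inr ⟨b, hb, rfl⟩, h⟩

theorem inv_sub_one_eq (hq : 1 < q) : (q - 1)⁻¹ = (q + 1) / (q ^ 2 - 1) := by
  have h8 : q - 1 ≠ 0 := by linarith
  have h9 : q + 1 ≠ 0 := by linarith
  rw [show q ^ 2 - 1 = (q - 1) * (q + 1) by ring]
  field_simp

/-- If both images of the switch point reached the region, it would branch; both avoiding it
contradicts `IsTail.add_ne`. The avoiding image supplies the tail, the other carries the
nonbranching orbit on. -/
theorem NonBranching.exists_stuckAt (hq : 1 < q) (hφ : 0 < q ^ 2 - q - 1)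
    (hφ' : (q ^ 2 - q - 1) * q ^ 3 < q - 1) (hR : q ∈ R) {w : ℝ} (h : NonBranching q R w)
    (h1 : 1 ≤ q * w) (h2 : q * w ≤ (q - 1)⁻¹) :
    ∃ t, StuckAt q R t ∧
      (t / (q ^ 2 - 1) = (q - 1)⁻¹ - q * w ∨ t / (q ^ 2 - 1) = q * w - 1) := by
  obtain ⟨⟨-, hw⟩, hB⟩ := h
  have hw0 : q * w ∈ R := R.mul_mem hR hw
  have hw1 : q * w - 1 ∈ R := R.sub_mem hw0 R.one_mem
  have hq2 : q ^ 2 - 1 ≠ 0 := by nlinarith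
  have low : ¬ Hits q (q * w - 1) → ∃ t, IsTail q t ∧ q * w - 1 = t / (q ^ 2 - 1) := by
    intro hh
    obtain ⟨t, ht, h⟩ := exists_isTail_of_not_hits (x := (q - 1)⁻¹ - (q * w - 1)) hq hφ hφ'
      (by linarith) (by linarith) (fun h => hh (by simpa using h.reflect hq))
    exact ⟨t, ht, by linarith⟩
  by_cases hh0 : Hits q (q * w)
  · have hh1 : ¬ Hits q (q * w - 1) := fun hh1 => hB (.here ⟨hh0, hw0⟩ ⟨hh1, hw1⟩)
    obtain ⟨t, ht, h⟩ := low hh1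
    refine ⟨t, ⟨.inr ⟨?_, ?_⟩, .inl (h ▸ hw1), ht⟩, .inr h.symm⟩
    · rw [← h, show (q - 1)⁻¹ - ((q - 1)⁻¹ - (q * w - 1) - 1) = q * w by ring]
      exact ⟨hh0, hw0⟩
    · rw [← h, show (q - 1)⁻¹ - ((q - 1)⁻¹ - (q * w - 1) - 1) = q * w by ring]
      exact fun h => hB (.zero ⟨hh0, hw0⟩ h)
  · obtain ⟨t, ht, h⟩ := exists_isTail_of_not_hits hq hφ hφ' h1 h2 hh0
    have hh1 : Hits q (q * w - 1) := by
      by_contra hh1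
      obtain ⟨s, hs, h'⟩ := low hh1
      refine IsTail.add_ne hq hφ hφ' hs ht ?_
      rw [h, inv_sub_one_eq hq] at h'
      field_simp at h'
      linarith
    refine ⟨t, ⟨.inl ?_, .inr (h ▸ hw0), ht⟩, .inl (by linarith)⟩
    rw [← h]
    exact ⟨⟨hh1, hw1⟩, fun h => hB (.one ⟨hh1, hw1⟩ h)⟩

/-- The transition rule between the tails of the points where a nonbranching orbit meets the switch
region. -/
theorem Stuck.exists_stuckAt (hq : 1 < q) (hφ : 0 < q ^ 2 - q - 1)
    (hφ' : (q ^ 2 - q - 1) * q ^ 3 < q - 1) (hR : q ∈ R) {w : ℝ} (h : Stuck q R w)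
    (h1 : 1 ≤ q * w) (h2 : q * w ≤ (q - 1)⁻¹) :
    ∃ t, StuckAt q R t ∧
      (t / (q ^ 2 - 1) = (q - 1)⁻¹ - q * w ∨ t / (q ^ 2 - 1) = q * w - 1) := by
  have hb := inv_sub_one_mul hq
  rcases h with h | h
  · exact h.exists_stuckAt hq hφ hφ' hR h1 h2
  · obtain ⟨t, ht, h⟩ := h.exists_stuckAt hq hφ hφ' hR (by linarith) (by linarith)
    exact ⟨t, ht, h.symm.imp (fun h => by linarith) (fun h => by linarith)⟩

end Stuck

/-! ### Transitions between tails -/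

section Transitions

variable {q : ℝ} {R : Subring ℝ}

/-- Scaling by q² - 1 clears the denominators of 1/(q - 1) and of the tails. -/
theorem Stuck.zero_div (hq : 1 < q) (hR : q ∈ R) {v : ℝ} (hv : q * v < q ^ 2 - 1)
    (h : Stuck q R (v / (q ^ 2 - 1))) : Stuck q R (q * v / (q ^ 2 - 1)) := by
  have hq2 : 0 < q ^ 2 - 1 := by nlinarith
  rw [mul_div_assoc]
  exact h.zero hq hR (by rwa [← mul_div_assoc, div_lt_one hq2])

theorem Stuck.exists_stuckAt_div (hq : 1 < q) (hφ : 0 < q ^ 2 - q - 1)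
    (hφ' : (q ^ 2 - q - 1) * q ^ 3 < q - 1) (hR : q ∈ R) {v : ℝ}
    (h : Stuck q R (v / (q ^ 2 - 1))) (h1 : q ^ 2 - 1 ≤ q * v) (h2 : q * v ≤ q + 1) :
    ∃ t, StuckAt q R t ∧ (t = q + 1 - q * v ∨ t = q * v - (q ^ 2 - 1)) := by
  have hq2 : 0 < q ^ 2 - 1 := by nlinarith
  obtain ⟨t, ht, h⟩ := h.exists_stuckAt hq hφ hφ' hR
    (by rwa [← mul_div_assoc, one_le_div hq2])
    (by rw [← mul_div_assoc, inv_sub_one_eq hq]; gcongr)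
  refine ⟨t, ht, h.imp (fun h => ?_) (fun h => ?_)⟩
  · rw [inv_sub_one_eq hq] at h
    field_simp at h
    linarith
  · field_simp at h
    linarith

theorem StuckAt.stuck (hq : 1 < q) {t : ℝ} (h : StuckAt q R t) :
    Stuck q R ((2 + q - q ^ 2 - t) / (q ^ 2 - 1)) := by
  have hq2 : q ^ 2 - 1 ≠ 0 := by nlinarith
  convert h.1 using 1
  rw [inv_sub_one_eq hq]
  field_simp
  ring

/-- One digit 0 is forced; the bound on `t` and q < q₃ then ensure a switch point. The two values of
`t'` correspond to which of its images avoids the region. -/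
theorem StuckAt.next_of_le (hq : 1 < q) (hφ : 0 < q ^ 2 - q - 1)
    (hφ' : (q ^ 2 - q - 1) * q ^ 3 < q - 1) (hR : q ∈ R) {t : ℝ} (h : StuckAt q R t)
    (ht : t ≤ (q⁻¹) ^ 3) :
    ∃ t', StuckAt q R t' ∧ (t' = (q ^ 2 - q - 1) * (q ^ 2 - 1) + q ^ 2 * t ∨
      t' = 1 - (q ^ 2 - q - 1) * q ^ 2 - q ^ 2 * t) := by
  have ht0 := h.2.2.nonneg hq
  have htq : q ^ 3 * t ≤ 1 := by
    rw [inv_pow, inv_eq_one_div, le_div_iff₀ (by positivity)] at ht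
    linarith
  have h1 := h.stuck hq |>.zero_div hq hR (by nlinarith)
  obtain ⟨t', ht', h'⟩ := h1.exists_stuckAt_div hq hφ hφ' hR
    (by
      rw [← sub_nonneg]
      have : 0 ≤ q * (q * (q * (2 + q - q ^ 2 - t)) - (q ^ 2 - 1)) := by nlinarith
      exact nonneg_of_mul_nonneg_right this (by linarith))
    (by nlinarith [mul_pos hφ (show 0 < q ^ 2 - 1 by nlinarith), mul_nonneg (sq_nonneg q) ht0])
  exact ⟨t', ht', h'.imp (fun h => by rw [h]; ring) (fun h => by rw [h]; ring)⟩

/-- A larger tail puts the starting point closer to 0: two zeros are forced here, three in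
`StuckAt.next_one`. -/
theorem StuckAt.next_two (hq : 1 < q) (hφ : 0 < q ^ 2 - q - 1)
    (hφ' : (q ^ 2 - q - 1) * q ^ 3 < q - 1) (hR : q ∈ R) (h : StuckAt q R ((q⁻¹) ^ 2)) :
    ∃ t', StuckAt q R t' ∧ (t' = (q ^ 2 - q - 1) * (q ^ 3 - q - 1) ∨
      t' = 1 - (q ^ 2 - q - 1) * (q ^ 3 - q)) := by
  obtain ⟨hq1, hq2⟩ := bounds_of_mem_Ioo hq hφ hφ'
  have hr : q ^ 2 * (q⁻¹) ^ 2 = 1 := by rw [← mul_pow, mul_inv_cancel₀ (by linarith), one_pow]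
  have hr0 : 0 < (q⁻¹) ^ 2 := by positivity
  generalize (q⁻¹) ^ 2 = t at *
  have h1 := h.stuck hq |>.zero_div hq hR (by nlinarith) |>.zero_div hq hR (by nlinarith)
  have he : q * (q * (q * (2 + q - q ^ 2 - t))) = q + 1 - (q ^ 2 - q - 1) * (q ^ 3 - q - 1) := by
    linear_combination -q * hr
  obtain ⟨t', ht', h'⟩ := h1.exists_stuckAt_div hq hφ hφ' hR (by rw [he]; nlinarith)
    (by rw [he]; nlinarith [mul_pos hφ (show 0 < q ^ 3 - q - 1 by nlinarith)])
  rw [he] at h'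
  exact ⟨t', ht', h'.imp (fun h => by rw [h]; ring) (fun h => by rw [h]; ring)⟩

theorem StuckAt.next_one (hq : 1 < q) (hφ : 0 < q ^ 2 - q - 1)
    (hφ' : (q ^ 2 - q - 1) * q ^ 3 < q - 1) (hR : q ∈ R) (h : StuckAt q R q⁻¹) :
    ∃ t', StuckAt q R t' ∧ (t' = (q ^ 2 - q - 1) * (q ^ 4 - q ^ 2 - 1) ∨
      t' = 1 - (q ^ 2 - q - 1) * (q ^ 4 - q ^ 2)) := by
  obtain ⟨hq1, hq2⟩ := bounds_of_mem_Ioo hq hφ hφ'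
  have hr : q * q⁻¹ = 1 := mul_inv_cancel₀ (by linarith)
  have hr0 : 0 < q⁻¹ := by positivity
  generalize q⁻¹ = t at *
  have hφ2 : 0 < (q ^ 2 - q - 1) * (q ^ 3 - q - 1) := mul_pos hφ (by nlinarith)
  have hφ4 : 0 < (q ^ 2 - q - 1) * (q ^ 4 - q ^ 2 - 1) := mul_pos hφ (by nlinarith)
  have h1 := h.stuck hq |>.zero_div hq hR (by nlinarith) |>.zero_div hq hR (by nlinarith)
    |>.zero_div hq hR (by nlinarith)
  have he : q * (q * (q * (q * (2 + q - q ^ 2 - t)))) =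
      q + 1 - (q ^ 2 - q - 1) * (q ^ 4 - q ^ 2 - 1) := by
    linear_combination -q ^ 3 * hr
  obtain ⟨t', ht', h'⟩ := h1.exists_stuckAt_div hq hφ hφ' hR (by rw [he]; nlinarith)
    (by rw [he]; linarith)
  rw [he] at h'
  exact ⟨t', ht', h'.imp (fun h => by rw [h]; ring) (fun h => by rw [h]; ring)⟩

end Transitions

/-! ### Elimination of tails -/

section Classification

variable {q : ℝ} {R : Subring ℝ}

theorem IsTail.not_between (hq : 1 < q) {t : ℝ} (ht : IsTail q t) {k : ℕ}
    (h1 : (q⁻¹) ^ (k + 1) < t) (h2 : t < (q⁻¹) ^ k) : False := by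
  rcases ht with rfl | ⟨b, hb, rfl⟩
  · have : 0 < (q⁻¹) ^ (k + 1) := by positivity
    linarith
  · have h0 : 0 < q⁻¹ := by positivity
    have h1' := (pow_lt_pow_iff_right_of_lt_one₀ h0 (inv_lt_one_of_one_lt₀ hq)).1 h1
    have h2' := (pow_lt_pow_iff_right_of_lt_one₀ h0 (inv_lt_one_of_one_lt₀ hq)).1 h2
    omega

theorem exists_inv_bounds (hq : 1 < q) (hφ : 0 < q ^ 2 - q - 1)
    (hφ' : (q ^ 2 - q - 1) * q ^ 3 < q - 1) :
    ∃ r, q⁻¹ = r ∧ r * q = 1 ∧ 0.595 < r ∧ r < 0.6181 ∧ 0.354 < r ^ 2 ∧ r ^ 2 < 0.3821 ∧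
      0.2106 < r ^ 3 ∧ r ^ 3 < 0.2362 ∧ r ^ 4 < 0.146 ∧ q ^ 2 - q - 1 < 0.1436 ∧
      1 - r - r ^ 2 = (q ^ 2 - q - 1) * r ^ 2 := by
  obtain ⟨hq1, hq2⟩ := bounds_of_mem_Ioo hq hφ hφ'
  have hrq : q⁻¹ * q = 1 := inv_mul_cancel₀ (by linarith)
  refine ⟨q⁻¹, rfl, hrq, ?_⟩
  generalize q⁻¹ = r at *
  have h1 : 0.595 < r := by nlinarith
  have h2 : r < 0.6181 := by nlinarith
  have h3 : 0.354 < r ^ 2 := by nlinarith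
  have h4 : r ^ 2 < 0.3821 := by nlinarith
  refine ⟨h1, h2, h3, h4, by nlinarith, by nlinarith, by nlinarith, by nlinarith, ?_⟩
  linear_combination (r - 1 - r * q) * hrq

/-- Multiplied by q, the difference of the sides is (q² - 1)(q - 1 - (q² - q - 1)q³). Thus the first
successor of q⁻¹ is below q⁻¹. -/
theorem mul_lt_inv_of_bound (hq : 1 < q) (hφ : 0 < q ^ 2 - q - 1)
    (hφ' : (q ^ 2 - q - 1) * q ^ 3 < q - 1) {r : ℝ} (hrq : r * q = 1) :
    (q ^ 2 - q - 1) * (q ^ 4 - q ^ 2 - 1) < r := by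
  have : q * (q ^ 2 - 1) * (q - 1 - (q ^ 2 - q - 1) * q ^ 3) =
      q ^ 2 * (r - (q ^ 2 - q - 1) * (q ^ 4 - q ^ 2 - 1)) := by
    linear_combination -q * hrq
  have h1 : 0 < q * (q ^ 2 - 1) * (q - 1 - (q ^ 2 - q - 1) * q ^ 3) :=
    mul_pos (mul_pos (by linarith) (by nlinarith)) (by linarith)
  rw [this] at h1
  have := (pos_iff_pos_of_mul_pos h1).1 (by positivity)
  linarith

theorem lt_of_le_inv_pow_four (hq : 1.618 < q) {r : ℝ} (hrq : r * q = 1)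
    (h : 1 - (q ^ 2 - q - 1) * q ^ 2 - r ≤ r ^ 4) : 1.66 < q := by
  by_contra! hq3
  have h4 : r ^ 4 * q ^ 4 = 1 := by rw [← mul_pow, hrq, one_pow]
  have h5 : (1 - (q ^ 2 - q - 1) * q ^ 2 - r) * q ^ 4 ≤ r ^ 4 * q ^ 4 := by gcongr
  have h6 : q ^ 4 - (q ^ 2 - q - 1) * q ^ 6 - q ^ 3 - 1 ≤ 0 := by
    linear_combination h5 + h4 + q ^ 3 * hrq
  clear h h4 h5 hrq
  -- After expansion about 1.66, the bounds on consecutive powers of `s` make the inequality linear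
  -- in the monomials.
  obtain ⟨s, rfl⟩ : ∃ s, q = 1.66 - s := ⟨1.66 - q, by ring⟩
  have hs0 : 0 ≤ s := by linarith
  have hs1 : s ≤ 0.042 := by linarith
  have f (k : ℕ) : 0 ≤ s ^ k ∧ s ^ (k + 1) ≤ 0.042 * s ^ k := by
    have : 0 ≤ s ^ k := by positivity
    exact ⟨this, by rw [pow_succ']; gcongr⟩
  have f1 := f 1
  have f3 := f 3
  have f5 := f 5
  have f7 := f 7
  norm_num at f1 f3 f5 f7
  ring_nf at h6
  linarith

/-- The first successor of q⁻³ exceeds q⁻¹; the second is positive and below q⁻². If it is q⁻³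
itself, the equation holds. If it is smaller, then q > 1.66, and within two more steps every
candidate misses the tails. -/
theorem StuckAt.of_cube (hq : 1 < q) (hφ : 0 < q ^ 2 - q - 1)
    (hφ' : (q ^ 2 - q - 1) * q ^ 3 < q - 1) (hR : q ∈ R) (h : StuckAt q R ((q⁻¹) ^ 3)) :
    (q ^ 2 - q - 1) * q ^ 2 + q⁻¹ + (q⁻¹) ^ 3 = 1 := by
  obtain ⟨hq1, hq2⟩ := bounds_of_mem_Ioo hq hφ hφ'
  obtain ⟨r, hr, hrq, hr1, hr2, hr3, hr4, hr5, hr6, hr7, hF, hrF⟩ := exists_inv_bounds hq hφ hφ'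
  obtain ⟨t, ht, h' | h'⟩ := h.next_of_le hq hφ hφ' hR le_rfl
  · have h1 := ht.2.2.le_inv hq
    rw [hr] at h' h1
    have : q ^ 2 * r ^ 3 = r := by linear_combination (r ^ 2 * q + r) * hrq
    have := mul_pos hφ (show 0 < q ^ 2 - 1 by nlinarith)
    linarith
  · rw [hr] at h' ⊢
    have hq2r : q ^ 2 * r ^ 3 = r := by linear_combination (r ^ 2 * q + r) * hrq
    rw [hq2r] at h'
    have hr0 : r ^ 2 < q ^ 2 := by nlinarith
    have htr : t < r ^ 2 := by nlinarith
    have ht0 : 0 < t := by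
      have : q * t = q - 1 - (q ^ 2 - q - 1) * q ^ 3 := by rw [h']; linear_combination -hrq
      nlinarith
    have ht1 := ht.2.2.eq_or_le hq 3
    rw [hr] at ht1
    rcases ht1 with ⟨b, hb, hb', ht1⟩ | ht1
    · interval_cases b
      · nlinarith
      · linarith
      · linarith
    exfalso
    norm_num at ht1
    have hq3 : 1.66 < q := lt_of_le_inv_pow_four hq1 hrq (by rw [← h']; exact ht1)
    have hF1 : 0.0956 < q ^ 2 - q - 1 := by nlinarith only [hq3]
    have hq4 : 2.7556 < q ^ 2 := by nlinarith only [hq3]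
    have hq5 : q ^ 2 < 2.8241 := by nlinarith only [hq1, hq2]
    have hr7' : r < 0.6025 := by nlinarith only [hrq, hq3, hr1]
    have hr8 : r ^ 2 < 0.3631 := by nlinarith only [hr7', hr1]
    have hr9 : r ^ 3 < 0.219 := by nlinarith only [hr8, hr1, hr7']
    have hr10 : r ^ 4 < r ^ 3 := by nlinarith only [hr5, hr7']
    obtain ⟨t', ht', h'' | h''⟩ := ht.next_of_le hq hφ hφ' hR (by rw [hr]; linarith)
    · have h3 : t' = 1 - (q ^ 2 - q - 1) * (q ^ 2 * (q ^ 2 - 1)) := by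
        rw [h'', h']; linear_combination -q * hrq
      have h4 : 4.837 < q ^ 2 * (q ^ 2 - 1) := by nlinarith only [hq4]
      have h5 : q ^ 2 * (q ^ 2 - 1) < 5.152 := by nlinarith only [hq4, hq5]
      have h6 : t' < 0.538 := by nlinarith only [h3, h4, hF1]
      have h7 : 0.26 < t' := by nlinarith only [h3, h5, hF, hφ, h4]
      have ht2 := ht'.2.2.eq_or_le hq 2
      rw [hr] at ht2
      rcases ht2 with ⟨b, hb, hb', ht2⟩ | ht2
      · interval_cases b
        · linarith
        · rw [ht2, ← hr] at ht'
          have hF4 : (q ^ 2 - q - 1) * q ^ 4 = 1 := by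
            have : ((q ^ 2 - q - 1) * q ^ 4 - 1) * (q ^ 2 - 1) = 0 := by
              have := ht2.symm.trans h3
              linear_combination q ^ 2 * this - (r * q + 1) * hrq
            rcases mul_eq_zero.1 this with h | h
            · linarith
            · linarith
          have hFr : q ^ 2 - q - 1 = r ^ 4 := by
            have : r ^ 4 * q ^ 4 = 1 := by rw [← mul_pow, hrq, one_pow]
            linear_combination r ^ 4 * hF4 - (q ^ 2 - q - 1) * this
          obtain ⟨t'', ht'', h4 | h4⟩ := ht'.next_two hq hφ hφ' hR
          · refine ht''.2.2.not_between hq (k := 2) ?_ ?_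
            · rw [h4, hFr, hr]
              have : r ^ 4 * (q ^ 3 - q - 1) = r ^ 3 + r ^ 4 * ((q + 1) * (q ^ 2 - q - 1)) := by
                linear_combination r ^ 3 * hrq
              rw [this]
              have : 0 < r ^ 4 * ((q + 1) * (q ^ 2 - q - 1)) := by positivity
              simpa using this
            · rw [h4, hr, hFr]
              have : r ^ 4 * (q ^ 3 - q - 1) = r ^ 2 - r ^ 4 * (1 + q + q ^ 2 - q ^ 3) := by
                linear_combination r ^ 2 * (r * q + 1) * hrq
              rw [this]
              have : 0 < r ^ 4 * (1 + q + q ^ 2 - q ^ 3) :=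
                mul_pos (by positivity) (by nlinarith only [hq1, hq2, hq5])
              linarith
          · have := ht''.2.2.le_inv hq
            rw [h4, hr] at this
            have h8 : (q ^ 2 - q - 1) * (q ^ 3 - q) = r - r ^ 3 := by
              rw [hFr]
              linear_combination (r ^ 3 * q ^ 2 + r ^ 2 * q + r - r ^ 3) * hrq
            linarith
      · norm_num at ht2
        linarith
    · have h3 : t' = (q ^ 2 - q - 1) * (q ^ 4 - q ^ 2 - 1) := by
        rw [h'', h']; linear_combination q * hrq
      refine ht'.2.2.not_between hq (k := 1) ?_ ?_
      · rw [hr, h3]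
        norm_num
        have : 3.837 < q ^ 4 - q ^ 2 - 1 := by nlinarith only [hq4]
        nlinarith only [this, hF1, hr8]
      · rw [pow_one, hr, h3]
        exact mul_lt_inv_of_bound hq hφ hφ' hrq

end Classification

section Classification

variable {q : ℝ} {R : Subring ℝ}

theorem polynomials_mono {c q : ℝ} (hc : 1 ≤ c) (h : c ≤ q) :
    c ^ 2 - c - 1 ≤ q ^ 2 - q - 1 ∧ c ^ 3 - c - 1 ≤ q ^ 3 - q - 1 ∧
      c ^ 4 - c ^ 2 - 1 ≤ q ^ 4 - q ^ 2 - 1 := by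
  have hqc : 0 ≤ q - c := by linarith
  have hc2 : 0 ≤ c ^ 2 - 1 := by nlinarith only [hc]
  have hq2 : 0 ≤ q ^ 2 - 1 := by nlinarith only [hc, h]
  have h2 : 0 ≤ (q - c) * (q + c - 1) := mul_nonneg hqc (by linarith)
  have h3 : 0 ≤ (q - c) * (q ^ 2 + q * c + (c ^ 2 - 1)) :=
    mul_nonneg hqc (by nlinarith only [hc2, hq2, hc, h])
  have h4 : 0 ≤ (q - c) * (q + c) * (q ^ 2 + (c ^ 2 - 1)) :=
    mul_nonneg (mul_nonneg hqc (by linarith)) (by nlinarith only [hc2, hq2])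
  exact ⟨by linarith, by linarith, by linarith⟩

theorem mul_sq_lt_of_le {c q d : ℝ} (hc : 1 ≤ q) (h : q ≤ c) (hφ : 0 < q ^ 2 - q - 1)
    (hd : (c ^ 2 - c - 1) * c ^ 2 < d) : (q ^ 2 - q - 1) * q ^ 2 < d := by
  refine lt_of_le_of_lt ?_ hd
  have h1 := (polynomials_mono hc h).1
  gcongr
  linarith

/-- A small tail has no successor if it is large enough relative to `q ^ 2 - q - 1`. -/
theorem StuckAt.false_of_small (hq : 1 < q) (hφ : 0 < q ^ 2 - q - 1)
    (hφ' : (q ^ 2 - q - 1) * q ^ 3 < q - 1) (hR : q ∈ R) {u : ℝ} (h : StuckAt q R u)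
    (hu : u ≤ (q⁻¹) ^ 4) (hu' : (q ^ 2 - q - 1) * (q ^ 2 - 1) < q ^ 2 * (q - 1) * u)
    (h4 : u = (q⁻¹) ^ 4 → (q ^ 2 - q - 1) * q ^ 2 < 0.2357)
    (h5 : u ≤ (q⁻¹) ^ 5 → (q ^ 2 - q - 1) * q ^ 2 < 0.14) : False := by
  obtain ⟨r, hr, hrq, hr1, hr2, hr3, hr4, hr5, hr6, hr7, hF, hrF⟩ := exists_inv_bounds hq hφ hφ'
  have hq2 : 0 < q ^ 2 - 1 := by nlinarith only [hq]
  have hF2 : 0 < (q ^ 2 - q - 1) * (q ^ 2 - 1) := mul_pos hφ hq2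
  obtain ⟨b, hb, rfl⟩ : ∃ b : ℕ, 4 ≤ b ∧ u = (q⁻¹) ^ b := by
    rcases h.2.2 with rfl | ⟨b, -, rfl⟩
    · linarith
    · refine ⟨b, ?_, rfl⟩
      rw [hr] at hu
      exact (pow_le_pow_iff_right_of_lt_one₀ (by linarith) (by linarith)).1 hu
  obtain ⟨c, rfl⟩ := Nat.exists_eq_add_of_le' hb
  obtain ⟨t, ht, h' | h'⟩ := h.next_of_le hq hφ hφ' hR
    (pow_le_pow_of_le_one (by positivity) (inv_le_one_of_one_le₀ hq.le) (by omega))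
  · rw [hr] at hu' h'
    have e2 : q ^ 2 * r ^ (c + 4) = r ^ (c + 2) := by
      linear_combination r ^ (c + 2) * (r * q + 1) * hrq
    have e3 : q ^ 2 * (q - 1) * r ^ (c + 4) = r ^ (c + 1) - r ^ (c + 2) := by
      linear_combination r ^ (c + 1) * (r * q + 1 + r ^ 2 * q ^ 2 - r * (r * q + 1)) * hrq
    -- The successor exceeds q^(-(c + 2)) by (q² - q - 1)(q² - 1), and `hu'` keeps it below q^(-(c +
    -- 1)).
    refine ht.2.2.not_between hq (k := c + 1) ?_ ?_ <;> rw [hr] <;> linarith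
  · rw [hr] at hu h4 h5 h'
    rcases hu.eq_or_lt with hu | hu
    · specialize h4 hu
      rw [hu, show q ^ 2 * r ^ 4 = r ^ 2 by linear_combination r ^ 2 * (r * q + 1) * hrq] at h'
      refine ht.2.2.not_between hq (k := 1) ?_ ?_
      · rw [hr]; norm_num; linarith
      · rw [hr, pow_one, h']
        nlinarith only [hrF, hφ, hr4, hq]
    · have hc : r ^ (c + 4) ≤ r ^ 5 := by
        refine pow_le_pow_of_le_one (by linarith) (by linarith) ?_
        have := (pow_lt_pow_iff_right_of_lt_one₀ (by linarith) (by linarith)).1 hu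
        omega
      specialize h5 hc
      have h3 : q ^ 2 * r ^ (c + 4) ≤ q ^ 2 * r ^ 5 := by gcongr
      rw [show q ^ 2 * r ^ 5 = r ^ 3 by linear_combination r ^ 3 * (r * q + 1) * hrq] at h3
      have := ht.2.2.le_inv hq
      rw [hr] at this
      linarith

/-- The first successor of q⁻² is smaller: it is q⁻³, or `StuckAt.false_of_small` excludes it. The
second can only be q⁻¹, whose own successors then lie strictly between consecutive powers. -/
theorem StuckAt.of_sq (hq : 1 < q) (hφ : 0 < q ^ 2 - q - 1)
    (hφ' : (q ^ 2 - q - 1) * q ^ 3 < q - 1) (hR : q ∈ R) (h : StuckAt q R ((q⁻¹) ^ 2)) :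
    (q ^ 2 - q - 1) * q ^ 2 + q⁻¹ + (q⁻¹) ^ 3 = 1 := by
  obtain ⟨hq1, hq2⟩ := bounds_of_mem_Ioo hq hφ hφ'
  obtain ⟨r, hr, hrq, hr1, hr2, hr3, hr4, hr5, hr6, hr7, hF, hrF⟩ := exists_inv_bounds hq hφ hφ'
  have hqq : q ^ 2 < 2.8241 := by nlinarith only [hq1, hq2]
  have hq3 : q ^ 3 < 4.747 := by nlinarith only [hq1, hq2, hqq]
  have hq4 : 1.61 < q ^ 3 - q - 1 :=
    lt_of_lt_of_le (by norm_num) (polynomials_mono (by norm_num) hq1.le).2.1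
  have hr4' : r ^ 4 * q ^ 4 = 1 := by rw [← mul_pow, hrq, one_pow]
  have hr5' : r ^ 5 * q ^ 5 = 1 := by rw [← mul_pow, hrq, one_pow]
  obtain ⟨t, ht, h' | h'⟩ := h.next_two hq hφ hφ' hR
  · have ht1 := ht.2.2.eq_or_le hq 3
    have htr : t < r ^ 2 := by nlinarith only [h', hF, hφ, hq3, hr3, hq1]
    rcases ht1 with ⟨b, hb, hb', ht1⟩ | ht1
    · rw [hr] at ht1
      interval_cases b
      · nlinarith only [ht1, htr, hr1, hr2]
      · linarith
      · rw [ht1, ← hr] at ht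
        exact ht.of_cube hq hφ hφ' hR
    · refine (ht.false_of_small hq hφ hφ' hR ht1 ?_ ?_ ?_).elim
      · have h1 : q ^ 2 - 1 < q ^ 2 * (q - 1) * (q ^ 3 - q - 1) := by
          have h2 : q + 1 < q ^ 2 * (q ^ 3 - q - 1) := by nlinarith only [hq1, hq4]
          nlinarith only [hq1, h2]
        rw [h']
        linarith only [mul_lt_mul_of_pos_left h1 hφ]
      · intro h4
        have h5 : (q ^ 2 - q - 1) * (q ^ 3 - q - 1) * q ^ 4 = 1 := by rw [← h', h4, hr, hr4']
        -- At the cutoff the product in `h5` already exceeds 1; below it, (q² - q - 1)q² is small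
        -- enough.
        have hq5 : q < 1.651 := by
          by_contra! hq5
          obtain ⟨h1, h2, -⟩ := polynomials_mono (by norm_num) hq5
          have h1 : 0.0748 ≤ q ^ 2 - q - 1 := le_trans (by norm_num) h1
          have h2 : 1.849 ≤ q ^ 3 - q - 1 := le_trans (by norm_num) h2
          have h3 : 7.429 ≤ q ^ 4 :=
            le_trans (by norm_num) (pow_le_pow_left₀ (by norm_num) hq5 4)
          have h6 : 0.0748 * 1.849 * 7.429 ≤ (q ^ 2 - q - 1) * (q ^ 3 - q - 1) * q ^ 4 := by gcongr
          norm_num [h5] at h6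
        exact mul_sq_lt_of_le hq.le hq5.le hφ (by norm_num)
      · intro h5
        have h5 : (q ^ 2 - q - 1) * (q ^ 3 - q - 1) * q ^ 5 ≤ 1 := by
          rw [← h', ← hr5', ← hr]; gcongr
        have hq5 : q < 1.64 := by
          by_contra! hq5
          obtain ⟨h1, h2, -⟩ := polynomials_mono (by norm_num) hq5
          have h1 : 0.0496 ≤ q ^ 2 - q - 1 := le_trans (by norm_num) h1
          have h2 : 1.77 ≤ q ^ 3 - q - 1 := le_trans (by norm_num) h2
          have h3 : 11.85 ≤ q ^ 5 :=
            le_trans (by norm_num) (pow_le_pow_left₀ (by norm_num) hq5 5)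
          have h6 : 0.0496 * 1.77 * 11.85 ≤ (q ^ 2 - q - 1) * (q ^ 3 - q - 1) * q ^ 5 := by gcongr
          have := h6.trans h5
          norm_num at this
        exact mul_sq_lt_of_le hq.le hq5.le hφ (by norm_num)
  · have ht1 := ht.2.2.eq_or_le hq 1
    rw [hr] at ht1
    have h1 : (q ^ 2 - q - 1) * (q ^ 3 - q) < 0.46 := by nlinarith only [hF, hφ, hq3, hq1]
    rcases ht1 with ⟨b, hb, hb', ht1⟩ | ht1
    · obtain rfl : b = 1 := by omega
      rw [pow_one] at ht1
      have h2 : (q ^ 2 - q - 1) * q ^ 2 * (q + 1) = 1 := by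
        have h3 : ((q ^ 2 - q - 1) * q ^ 2 * (q + 1) - 1) * (q - 1) = 0 := by
          linear_combination q * (ht1.symm.trans h') - hrq
        rcases mul_eq_zero.1 h3 with h | h <;> linarith
      rw [ht1, ← hr] at ht
      exfalso
      have h6 : 0 < 1 - 2 * q ^ 2 + q ^ 3 := by
        have : 0 < (q - 1) * (q ^ 2 - q - 1) := mul_pos (by linarith) hφ
        linarith
      obtain ⟨t', ht', h5 | h5⟩ := ht.next_one hq hφ hφ' hR
      · have h7 : t' = q * (2 - q) := by
          rw [h5]; linear_combination (q - 1) * h2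
        refine ht'.2.2.not_between hq (k := 1) ?_ ?_
        · rw [hr, h7]
          norm_num
          nlinarith only [hq1, hq2, hr4]
        · have h8 : r - q * (2 - q) = r * (1 - 2 * q ^ 2 + q ^ 3) := by
            linear_combination (2 * q - q ^ 2) * hrq
          have : 0 < r * (1 - 2 * q ^ 2 + q ^ 3) := mul_pos (by linarith) h6
          rw [hr, pow_one, h7]
          linarith
      · have h7 : t' = 2 - q := by
          rw [h5]; linear_combination -(q - 1) * h2
        refine ht'.2.2.not_between hq (k := 2) ?_ ?_
        · rw [hr, h7]
          norm_num
          linarith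
        · have h8 : r ^ 2 - (2 - q) = r ^ 2 * (1 - 2 * q ^ 2 + q ^ 3) := by
            linear_combination (2 - q) * (r * q + 1) * hrq
          have : 0 < r ^ 2 * (1 - 2 * q ^ 2 + q ^ 3) := mul_pos (by positivity) h6
          rw [hr, h7]
          linarith
    · norm_num at ht1
      linarith

/-- The second equation says that q⁻¹ is its own successor. Other successors are q⁻² or q⁻³, or are
excluded by `StuckAt.false_of_small` or by size. -/
theorem StuckAt.of_inv (hq : 1 < q) (hφ : 0 < q ^ 2 - q - 1)
    (hφ' : (q ^ 2 - q - 1) * q ^ 3 < q - 1) (hR : q ∈ R) (h : StuckAt q R q⁻¹) :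
    (q ^ 2 - q - 1) * q ^ 2 + q⁻¹ + (q⁻¹) ^ 3 = 1 ∨
      (q ^ 2 - q - 1) * (q ^ 4 - q ^ 2) + q⁻¹ = 1 := by
  obtain ⟨hq1, hq2⟩ := bounds_of_mem_Ioo hq hφ hφ'
  obtain ⟨r, hr, hrq, hr1, hr2, hr3, hr4, hr5, hr6, hr7, hF, hrF⟩ := exists_inv_bounds hq hφ hφ'
  have hq4 : 3.23 < q ^ 4 - q ^ 2 - 1 :=
    lt_of_lt_of_le (by norm_num) (polynomials_mono (by norm_num) hq1.le).2.2
  have hr4' : r ^ 4 * q ^ 4 = 1 := by rw [← mul_pow, hrq, one_pow]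
  obtain ⟨t, ht, h' | h'⟩ := h.next_one hq hφ hφ' hR
  · left
    have ht1 := ht.2.2.eq_or_le hq 3
    have htr : t < r := h' ▸ mul_lt_inv_of_bound hq hφ hφ' hrq
    rcases ht1 with ⟨b, hb, hb', ht1⟩ | ht1
    · rw [ht1] at ht
      interval_cases b
      · rw [hr, pow_one] at ht1
        linarith
      · exact ht.of_sq hq hφ hφ' hR
      · exact ht.of_cube hq hφ hφ' hR
    · have h5 : (q ^ 2 - q - 1) * (q ^ 4 - q ^ 2 - 1) * q ^ 4 ≤ 1 := by
        rw [← h', ← hr4', ← hr]; gcongr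
      have hq5 : q < 1.638 := by
        by_contra! hq5
        obtain ⟨h1, -, h2⟩ := polynomials_mono (by norm_num) hq5
        have h1 : 0.045 ≤ q ^ 2 - q - 1 := le_trans (by norm_num) h1
        have h2 : 3.515 ≤ q ^ 4 - q ^ 2 - 1 := le_trans (by norm_num) h2
        have h3 : 7.19 ≤ q ^ 4 := le_trans (by norm_num) (pow_le_pow_left₀ (by norm_num) hq5 4)
        have h6 : 0.045 * 3.515 * 7.19 ≤ (q ^ 2 - q - 1) * (q ^ 4 - q ^ 2 - 1) * q ^ 4 := by gcongr
        have := h6.trans h5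
        norm_num at this
      have h6 : (q ^ 2 - q - 1) * q ^ 2 < 0.14 :=
        mul_sq_lt_of_le hq.le hq5.le hφ (by norm_num)
      refine (ht.false_of_small hq hφ hφ' hR ht1 ?_ (fun _ => by linarith) (fun _ => h6)).elim
      have h1 : q ^ 2 - 1 < q ^ 2 * (q - 1) * (q ^ 4 - q ^ 2 - 1) := by
        have h2 : q + 1 < q ^ 2 * (q ^ 4 - q ^ 2 - 1) := by nlinarith only [hq1, hq4]
        nlinarith only [hq1, h2]
      rw [h']
      linarith only [mul_lt_mul_of_pos_left h1 hφ]
  · have ht1 := ht.2.2.eq_or_le hq 2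
    rcases ht1 with ⟨b, hb, hb', ht1⟩ | ht1
    · interval_cases b
      · right
        rw [pow_one] at ht1
        linarith
      · left
        rw [ht1] at ht
        exact ht.of_sq hq hφ hφ' hR
    · rw [hr] at ht1
      have h1 : q ^ 2 < 2.8241 := by nlinarith only [hq1, hq2]
      have h2 : q ^ 4 - q ^ 2 < 5.1515 := by nlinarith only [h1, hq1]
      norm_num at ht1
      nlinarith only [h2, hF, hφ, ht1, hr6, h', hq4]

/-- The two bases between the golden ratio and `q₃` for which some numbers have countably many
expansions satisfy one of two equations. -/
theorem StuckAt.of_inv_pow (hq : 1 < q) (hφ : 0 < q ^ 2 - q - 1)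
    (hφ' : (q ^ 2 - q - 1) * q ^ 3 < q - 1) (hR : q ∈ R) :
    ∀ a : ℕ, 1 ≤ a → StuckAt q R ((q⁻¹) ^ a) →
      (q ^ 2 - q - 1) * q ^ 2 + q⁻¹ + (q⁻¹) ^ 3 = 1 ∨
        (q ^ 2 - q - 1) * (q ^ 4 - q ^ 2) + q⁻¹ = 1 := by
  obtain ⟨hq1, hq2⟩ := bounds_of_mem_Ioo hq hφ hφ'
  obtain ⟨r, hr, hrq, hr1, hr2, hr3, hr4, hr5, hr6, hr7, hF, hrF⟩ := exists_inv_bounds hq hφ hφ'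
  have hF2 : 0 < (q ^ 2 - q - 1) * (q ^ 2 - 1) := mul_pos hφ (by nlinarith only [hq])
  intro a
  induction a using Nat.strong_induction_on with
  | _ a ih =>
    intro ha h
    rcases lt_or_ge a 4 with h4 | h4
    · interval_cases a
      · exact StuckAt.of_inv hq hφ hφ' hR (by simpa using h)
      · exact .inl (h.of_sq hq hφ hφ' hR)
      · exact .inl (h.of_cube hq hφ hφ' hR)
    obtain ⟨t, ht, h'⟩ := h.next_of_le hq hφ hφ' hR
      (pow_le_pow_of_le_one (by positivity) (inv_le_one_of_one_le₀ hq.le) (by omega))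
    -- From a ≥ 4 on, both successors are strictly larger, so the exponent drops until it is at most
    -- 3.
    have hta : (q⁻¹) ^ a < t := by
      have ha0 : 0 < (q⁻¹) ^ a := by positivity
      rcases h' with h' | h'
      · rw [h']
        nlinarith only [mul_pos ha0 (show 0 < q ^ 2 - 1 by nlinarith only [hq]), hF2]
      · have ha1 : (q⁻¹) ^ a ≤ (q⁻¹) ^ 4 :=
          pow_le_pow_of_le_one (by positivity) (inv_le_one_of_one_le₀ hq.le) h4
        have h1 : q ^ 2 * (q⁻¹) ^ a ≤ q ^ 2 * (q⁻¹) ^ 4 := by gcongr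
        rw [hr] at h1 ha1 h' ⊢
        rw [show q ^ 2 * r ^ 4 = r ^ 2 by linear_combination r ^ 2 * (r * q + 1) * hrq] at h1
        have h2 : (q ^ 2 - q - 1) * q ^ 2 < 1 - r := by
          have : q * (1 - r - (q ^ 2 - q - 1) * q ^ 2) =
              q - 1 - (q ^ 2 - q - 1) * q ^ 3 := by linear_combination -hrq
          nlinarith only [this, hφ', hq]
        linarith
    obtain rfl | ⟨b, hb, rfl⟩ := ht.2.2
    · have : 0 < (q⁻¹) ^ a := by positivity
      linarith
    · refine ih b ?_ hb ht
      exact (pow_lt_pow_iff_right_of_lt_one₀ (by positivity) (inv_lt_one_of_one_lt₀ hq)).1 hta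

/-- The zero tail does not persist: both of its successors are positive. -/
theorem StuckAt.exists_inv_pow (hq : 1 < q) (hφ : 0 < q ^ 2 - q - 1)
    (hφ' : (q ^ 2 - q - 1) * q ^ 3 < q - 1) (hR : q ∈ R) {t : ℝ} (h : StuckAt q R t) :
    ∃ a : ℕ, 1 ≤ a ∧ StuckAt q R ((q⁻¹) ^ a) := by
  rcases h.2.2 with rfl | ⟨a, ha, rfl⟩
  · have hF2 : 0 < (q ^ 2 - q - 1) * (q ^ 2 - 1) := mul_pos hφ (by nlinarith only [hq])
    obtain ⟨t, ht, h'⟩ := h.next_of_le hq hφ hφ' hR (by positivity)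
    rcases ht.2.2 with rfl | ⟨b, hb, rfl⟩
    · exfalso
      rcases h' with h' | h'
      · linarith
      · nlinarith only [h', hφ', hq]
    · exact ⟨b, hb, ht⟩
  · exact ⟨a, ha, h⟩

end Classification

/-! ### Two irreducible sextics and the ring ℤ[q] -/

-- A proper monic factorisation has a factor of degree 1, 2 or 3. Comparing coefficients makes each
-- case a finite check over `ZMod 2`, left to `decide` for concrete `f`.
open Polynomial in
theorem irreducible_zmod_two_of_coeff {f : (ZMod 2)[X]} (hf : f.Monic) (hd : f.natDegree = 6)
    (h1 : ∀ a b₀ b₁ b₂ b₃ b₄ : ZMod 2, a * b₀ = f.coeff 0 → a * b₁ + b₀ = f.coeff 1 →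
      a * b₂ + b₁ = f.coeff 2 → a * b₃ + b₂ = f.coeff 3 → a * b₄ + b₃ = f.coeff 4 →
      a + b₄ ≠ f.coeff 5)
    (h2 : ∀ a₀ a₁ b₀ b₁ b₂ b₃ : ZMod 2, a₀ * b₀ = f.coeff 0 → a₀ * b₁ + a₁ * b₀ = f.coeff 1 →
      a₀ * b₂ + a₁ * b₁ + b₀ = f.coeff 2 → a₀ * b₃ + a₁ * b₂ + b₁ = f.coeff 3 →
      a₀ + a₁ * b₃ + b₂ = f.coeff 4 → a₁ + b₃ ≠ f.coeff 5)
    (h3 : ∀ a₀ a₁ a₂ b₀ b₁ b₂ : ZMod 2, a₀ * b₀ = f.coeff 0 → a₀ * b₁ + a₁ * b₀ = f.coeff 1 →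
      a₀ * b₂ + a₁ * b₁ + a₂ * b₀ = f.coeff 2 → a₀ + a₁ * b₂ + a₂ * b₁ + b₀ = f.coeff 3 →
      a₁ + a₂ * b₂ + b₁ = f.coeff 4 → a₂ + b₂ ≠ f.coeff 5) :
    Irreducible f := by
  rw [hf.irreducible_iff_lt_natDegree_lt (by rintro rfl; simp at hd)]
  rintro g hg hgd ⟨h, rfl⟩
  have hh : h.Monic := hg.of_mul_monic_left hf
  rw [hg.natDegree_mul hh] at hd
  have hgz : ∀ n, g.natDegree < n → g.coeff n = 0 := fun n hn => coeff_eq_zero_of_natDegree_lt hn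
  have hhz : ∀ n, h.natDegree < n → h.coeff n = 0 := fun n hn => coeff_eq_zero_of_natDegree_lt hn
  have hgl : g.coeff g.natDegree = 1 := hg
  have hhl : h.coeff h.natDegree = 1 := hh
  rw [hg.natDegree_mul hh, hd, Finset.mem_Ioc] at hgd
  obtain ⟨hd1, hd2⟩ := hgd
  norm_num at hd2
  interval_cases hdg : g.natDegree
  · obtain hdh : h.natDegree = 5 := by omega
    rw [hdh] at hhz hhl
    refine h1 (g.coeff 0) (h.coeff 0) (h.coeff 1) (h.coeff 2) (h.coeff 3) (h.coeff 4)
      ?_ ?_ ?_ ?_ ?_ ?_ <;>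
    simp [coeff_mul, Finset.Nat.antidiagonal_succ, hgz, hhz, hgl, hhl]
  · obtain hdh : h.natDegree = 4 := by omega
    rw [hdh] at hhz hhl
    refine h2 (g.coeff 0) (g.coeff 1) (h.coeff 0) (h.coeff 1) (h.coeff 2) (h.coeff 3)
      ?_ ?_ ?_ ?_ ?_ ?_ <;>
    simp [coeff_mul, Finset.Nat.antidiagonal_succ, hgz, hhz, hgl, hhl, add_assoc]
  · obtain hdh : h.natDegree = 3 := by omega
    rw [hdh] at hhz hhl
    refine h3 (g.coeff 0) (g.coeff 1) (g.coeff 2) (h.coeff 0) (h.coeff 1) (h.coeff 2)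
      ?_ ?_ ?_ ?_ ?_ ?_ <;>
    simp [coeff_mul, Finset.Nat.antidiagonal_succ, hgz, hhz, hgl, hhl, add_assoc]

open Polynomial in
set_option synthInstance.maxHeartbeats 200000 in
set_option synthInstance.maxSize 1000 in
theorem irreducible_sextic_one :
    Irreducible (X ^ 6 - X ^ 4 - X ^ 3 - 2 * X ^ 2 - X - 1 : ℤ[X]) := by
  have hm : (X ^ 6 - X ^ 4 - X ^ 3 - 2 * X ^ 2 - X - 1 : ℤ[X]).Monic := by monicity!
  refine hm.irreducible_of_irreducible_map (Int.castRingHom (ZMod 2)) _ ?_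
  have he : (X ^ 6 - X ^ 4 - X ^ 3 - 2 * X ^ 2 - X - 1 : ℤ[X]).map (Int.castRingHom (ZMod 2)) =
      X ^ 6 + X ^ 4 + X ^ 3 + X + 1 := by
    have h2 : (2 : (ZMod 2)[X]) = 0 := CharTwo.two_eq_zero
    simp only [Polynomial.map_sub, Polynomial.map_mul, Polynomial.map_pow, map_X,
      Polynomial.map_ofNat, Polynomial.map_one, h2]
    linear_combination -(X ^ 4 + X ^ 3 + X + 1) * h2
  rw [he]
  have hd : (X ^ 6 + X ^ 4 + X ^ 3 + X + 1 : (ZMod 2)[X]).natDegree = 6 := by compute_degree!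
  refine irreducible_zmod_two_of_coeff (by monicity!) hd ?_ ?_ ?_ <;>
  simp [coeff_one, coeff_X] <;> decide

open Polynomial in
set_option synthInstance.maxHeartbeats 200000 in
set_option synthInstance.maxSize 1000 in
theorem irreducible_sextic_two :
    Irreducible (X ^ 6 - 2 * X ^ 4 - X ^ 3 - 1 : ℤ[X]) := by
  have hm : (X ^ 6 - 2 * X ^ 4 - X ^ 3 - 1 : ℤ[X]).Monic := by monicity!
  refine hm.irreducible_of_irreducible_map (Int.castRingHom (ZMod 2)) _ ?_
  have he : (X ^ 6 - 2 * X ^ 4 - X ^ 3 - 1 : ℤ[X]).map (Int.castRingHom (ZMod 2)) =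
      X ^ 6 + X ^ 3 + 1 := by
    have h2 : (2 : (ZMod 2)[X]) = 0 := CharTwo.two_eq_zero
    simp only [Polynomial.map_sub, Polynomial.map_mul, Polynomial.map_pow, map_X,
      Polynomial.map_ofNat, Polynomial.map_one, h2]
    linear_combination -(X ^ 3 + 1) * h2
  rw [he]
  have hd : (X ^ 6 + X ^ 3 + 1 : (ZMod 2)[X]).natDegree = 6 := by compute_degree!
  refine irreducible_zmod_two_of_coeff (by monicity!) hd ?_ ?_ ?_ <;>
  simp [coeff_one] <;> decide

open Polynomial in
theorem dvd_of_irreducible_of_aeval_eq_zero {f P : ℤ[X]} (hm : f.Monic) (hf : Irreducible f)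
    {q : ℝ} (h : aeval q f = 0) (hP : aeval q P = 0) : f ∣ P := by
  have hi : IsIntegral ℤ q := ⟨f, hm, h⟩
  have h1 := minpoly.isIntegrallyClosed_dvd hi h
  have h2 := minpoly.isIntegrallyClosed_dvd hi hP
  exact ((hf.dvd_iff.1 h1).resolve_left (minpoly.not_isUnit ℤ q)).dvd.trans h2

open Polynomial in
/-- The ring `ℤ[q]`. -/
noncomputable def integerPolynomialsAt (q : ℝ) : Subring ℝ := (aeval q : ℤ[X] →ₐ[ℤ] ℝ).toRingHom.range

open Polynomial in
/-- If the value at `1` of the minimal polynomial of `q` is not `± 1`, then no tail of the form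
`0 … 0 (01)^∞` occurs in an expansion of an element of `ℤ[q]`. -/
theorem StuckAt.isUnit_eval_one {q : ℝ} (hq : 1 < q) {f : ℤ[X]} (hm : f.Monic)
    (hf : Irreducible f) (hfq : aeval q f = 0) {b : ℕ}
    (h : StuckAt q (integerPolynomialsAt q) ((q⁻¹) ^ b)) : IsUnit (f.eval 1) := by
  have hq2 : q ^ 2 - 1 ≠ 0 := by nlinarith
  have hqb : q ^ b ≠ 0 := by positivity
  -- Clear denominators in the membership relation; the factor X² - 1 removes the unknown `A` at 1.
  have : ∃ P : ℤ[X], aeval q P = 0 ∧ P.eval 1 = -1 := by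
    rcases h.2.1 with ⟨A, hA⟩ | ⟨A, hA⟩
    · refine ⟨A * (X ^ 2 - 1) * X ^ b - 1, ?_, by simp⟩
      have hA' : aeval q A = (q⁻¹) ^ b / (q ^ 2 - 1) := hA
      simp only [map_sub, map_mul, hA', map_pow, aeval_X, map_one, inv_pow]
      field_simp
      ring
    · refine ⟨A * (X ^ 2 - 1) * X ^ b - (X + 1) * X ^ b + 1, ?_, by simp⟩
      have hA' : aeval q A = (q - 1)⁻¹ - (q⁻¹) ^ b / (q ^ 2 - 1) := hA
      simp only [map_sub, map_add, map_mul, hA', map_pow, aeval_X, map_one, inv_pow]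
      rw [inv_sub_one_eq hq]
      field_simp
      ring
  obtain ⟨P, hP, hP1⟩ := this
  have h1 := eval_dvd (x := 1) (dvd_of_irreducible_of_aeval_eq_zero hm hf hfq hP)
  rw [hP1] at h1
  exact isUnit_of_dvd_unit h1 (by norm_num)

/-! ### Conclusion -/

/-- The quintic is -1 at 1, so a nonnegative value at q would give a root in (1, q], against the
uniqueness of q₃. -/
theorem quintic_neg_of_lt {q : ℝ} (hq : 1 < q) (hq' : q < q₃) :
    (q ^ 2 - q - 1) * q ^ 3 < q - 1 := by
  by_contra! h
  obtain ⟨x, ⟨hx1, hx2⟩, hx⟩ : (0 : ℝ) ∈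
      (fun x : ℝ => x ^ 5 - x ^ 4 - x ^ 3 - x + 1) '' Set.Icc 1 q :=
    intermediate_value_Icc hq.le (by fun_prop) ⟨by norm_num, by linarith⟩
  have hx1' : 1 < x := by
    refine hx1.lt_of_ne ?_
    rintro rfl
    norm_num at hx
  have := existsUnique_q₃.unique ⟨hx1', hx⟩ q₃_spec
  linarith

open Polynomial in
theorem branches_of_hitsIn {q : ℝ} (hq : 1 < q) (hφ : 0 < q ^ 2 - q - 1)
    (hφ' : (q ^ 2 - q - 1) * q ^ 3 < q - 1) (x : ℝ)
    (hx : HitsIn q (integerPolynomialsAt q) x) :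
    Branches q (HitsIn q (integerPolynomialsAt q)) x := by
  by_contra hB
  have hR : q ∈ integerPolynomialsAt q := ⟨X, aeval_X q⟩
  have hN : NonBranching q (integerPolynomialsAt q) x := ⟨hx, hB⟩
  obtain ⟨w, hw, hw1, hw2⟩ := hN.exists_switch hq hR
  obtain ⟨t, ht, -⟩ := hw.exists_stuckAt hq hφ hφ' hR hw1 hw2
  obtain ⟨a, ha, h⟩ := ht.exists_inv_pow hq hφ hφ' hR
  have hq0 : q ≠ 0 := by positivity
  have hq1 : q - 1 ≠ 0 := by linarith
  rcases h.of_inv_pow hq hφ hφ' hR a ha with h1 | h1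
  · have hroot : aeval q (X ^ 6 - X ^ 4 - X ^ 3 - 2 * X ^ 2 - X - 1 : ℤ[X]) = 0 := by
      field_simp at h1
      have : (q - 1) * (q ^ 6 - q ^ 4 - q ^ 3 - 2 * q ^ 2 - q - 1) = 0 := by
        linear_combination h1
      simpa [map_ofNat (aeval q) 2] using (mul_eq_zero.1 this).resolve_left hq1
    -- The value at 1 is -5 here and -3 for the other sextic.
    have := h.isUnit_eval_one hq (by monicity!) irreducible_sextic_one hroot
    rw [Int.isUnit_iff] at this
    norm_num at this
  · have hroot : aeval q (X ^ 6 - 2 * X ^ 4 - X ^ 3 - 1 : ℤ[X]) = 0 := by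
      field_simp at h1
      have : (q - 1) * (q ^ 6 - 2 * q ^ 4 - q ^ 3 - 1) = 0 := by
        linear_combination h1
      simpa [map_ofNat (aeval q) 2] using (mul_eq_zero.1 this).resolve_left hq1
    have := h.isUnit_eval_one hq (by monicity!) irreducible_sextic_two hroot
    rw [Int.isUnit_iff] at this
    norm_num at this

theorem mainTheorem4 (q : ℝ) (hq : q ∈ Set.Ioo 1 q₃ \ {(1 + √5) / 2}) :
    Cardinal.mk (qExpansions q 1) = 2 ^ Cardinal.aleph0 := by
  obtain ⟨⟨hq1, hq3⟩, hqG⟩ := hq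
  have h5 : √5 ^ 2 = 5 := Real.sq_sqrt (by norm_num)
  have hne : q ^ 2 - q - 1 ≠ 0 := by
    intro h
    have : (q - (1 + √5) / 2) * (q - (1 - √5) / 2) = 0 := by linear_combination h - h5 / 4
    rcases mul_eq_zero.1 this with h | h
    · exact hqG (by rw [Set.mem_singleton_iff]; linarith)
    · linarith [Real.sqrt_nonneg 5]
  rcases hne.lt_or_gt with hφ | hφ
  · refine mk_qExpansions_of_branches hq1 (C := 1 / (q - 1)) (fun x hx => ?_)
      (branches_interior hq1 hφ) ⟨one_pos, ?_⟩
    · rw [abs_of_pos hx.1]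
      exact hx.2.le
    · rw [lt_div_iff₀ (by linarith)]
      nlinarith
  · have hφ' := quintic_neg_of_lt hq1 hq3
    -- Digit 1 sends the point 1 to q - 1, which lies in the switch region.
    refine mk_qExpansions_of_branches hq1 (C := (q - 1)⁻¹) (fun x hx => ?_)
      (branches_of_hitsIn hq1 hφ hφ') ⟨.one (.mem (by linarith) ?_), Subring.one_mem _⟩
    · have := hx.1.mem_Icc hq1
      rw [abs_of_nonneg this.1]
      exact this.2
    · obtain ⟨-, hq2⟩ := bounds_of_mem_Ioo hq1 hφ hφ'
      rw [inv_eq_one_div, le_div_iff₀ (by linarith)]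
      nlinarith
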